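/- Theorem 2.7 (Stanley). Let $k$ be an infinite field. A Gorenstein $h$-vector of codimension $r$ over $k$ is the Hilbert function $h=(1,h_1,\dots,h_e)$, $h_d=\dim_k A_d$, $h_e\neq 0$, $h_1=r$, of a standard graded artinian Gorenstein $k$-algebra $A$, that is, of an artinian quotient $A=k[x_1,\dots,x_n]/I$ by a homogeneous ideal $I$ whose socle $\{a\in A : x_1a=\dots=x_na=0\}$ is one-dimensional over $k$. Every Gorenstein $h$-vector of codimension $r\le 3$ is unimodal: there is an index $m$ with $0\le m\le e$ and $$h_0\le h_1\le\dots\le h_m\ge h_{m+1}\ge\dots\ge h_e.$$ -/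

import Mathlib

open MvPolynomial

namespace GorensteinH

attribute [local instance] MvPolynomial.gradedAlgebra

variable {k : Type*} [Field k] {n : ℕ}

/-- The degree `d` component of the graded algebra `A = k[x₁, …, xₙ] / I`: the image in `A` of the
space of homogeneous polynomials of degree `d`. -/
noncomputable def gradedPiece (I : Ideal (MvPolynomial (Fin n) k)) (d : ℕ) :
    Submodule k (MvPolynomial (Fin n) k ⧸ I) :=
  (homogeneousSubmodule (Fin n) k d).map (Ideal.Quotient.mkₐ k I).toLinearMap

/-- The Hilbert function `d ↦ h_d = dim_k A_d` of `A = k[x₁, …, xₙ] / I`. When `A` is artinian it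
vanishes from some point on, and its nonzero initial part is the `h`-vector `(h₀, …, h_e)`
of `A`. -/
noncomputable def hilbertFunction (I : Ideal (MvPolynomial (Fin n) k)) (d : ℕ) : ℕ :=
  Module.finrank k (gradedPiece I d)

/-- The codimension `h₁ = dim_k A₁` of `A = k[x₁, …, xₙ] / I`, which for homogeneous `I` is
the least number of variables in a presentation of `A`. For a proper homogeneous ideal `I` it
equals `n` exactly when `I` contains no nonzero linear form. -/
noncomputable def codimension (I : Ideal (MvPolynomial (Fin n) k)) : ℕ :=
  hilbertFunction I 1

/-- The socle of `A = k[x₁, …, xₙ] / I`: the annihilator in `A` of the irrelevant maximal ideal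
`(x₁, …, xₙ)`. -/
def socle (I : Ideal (MvPolynomial (Fin n) k)) : Ideal (MvPolynomial (Fin n) k ⧸ I) where
  carrier := {a | ∀ i : Fin n, Ideal.Quotient.mk I (X i) * a = 0}
  zero_mem' := fun _ => mul_zero _
  add_mem' := fun {a b} ha hb i => by rw [mul_add, ha i, hb i, add_zero]
  smul_mem' := fun c a ha i => by rw [smul_eq_mul, mul_left_comm, ha i, mul_zero]

/-- `A = k[x₁, …, xₙ] / I` is a standard graded artinian Gorenstein `k`-algebra: `I` is homogeneous,
`A` is artinian, and its socle is one-dimensional over `k`. -/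
structure IsArtinianGorenstein (I : Ideal (MvPolynomial (Fin n) k)) : Prop where
  homogeneous : I.IsHomogeneous (homogeneousSubmodule (Fin n) k)
  artinian : IsArtinianRing (MvPolynomial (Fin n) k ⧸ I)
  finrank_socle : Module.finrank k (socle I) = 1

/-- The sequence `h` is a Gorenstein `h`-vector of codimension `r` over `k` (continued by zeros):
it is the Hilbert function of a standard graded artinian Gorenstein `k`-algebra of
codimension `r`. -/
def IsGorensteinHVector (k : Type*) [Field k] (r : ℕ) (h : ℕ → ℕ) : Prop :=
  ∃ (n : ℕ) (I : Ideal (MvPolynomial (Fin n) k)),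
    IsArtinianGorenstein I ∧ codimension I = r ∧ h = hilbertFunction I

/-- `h₀ ≤ h₁ ≤ … ≤ h_m ≥ h_{m+1} ≥ …` for some `m`. For a vector of nonnegative integers continued
by zeros this is unimodality of the vector. -/
def IsUnimodal (h : ℕ → ℕ) : Prop :=
  ∃ m : ℕ, MonotoneOn h (Set.Iic m) ∧ AntitoneOn h (Set.Ici m)

end GorensteinH

open MvPolynomial

namespace GorensteinH

attribute [local instance] MvPolynomial.gradedAlgebra

/-! ### Ranks of multiplication maps -/

section LinearAlgebra

variable {k : Type*} [Field k]

/-! Let `e` be the socle degree. Duality gives `h_i = h_(e-i)`, so it suffices that `h_d ≤ h_(d+1)`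
for `2d+1 ≤ e`. Take three linear generators of `A`. If they satisfy no relation of degree `d+1`, a
generator multiplies `A_d` injectively (`hilbertFunction_le_succ_of_forall_aeval_ne_zero`).

Otherwise `A_(d+1) = y A_d + z A_d` for two linear forms (`exists_pair_of_aeval_eq_zero`). Beyond
degree `d`, `A/zA` is then generated by powers of `y` over its part of degree `d+1`, so `dim
(A/zA)_(j+1) = h_(j+1) - rank (z on A_j)` does not increase for `j ≥ d`. Compare `j = d` with `j =
e-d-1`: the two ranks of `z` are dual and cancel, leaving `h_(e-d) ≤ h_(d+1)`, where `h_(e-d) =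
h_d`. -/

theorem finrank_range_le_of_ker_le {P X Y : Type*} [AddCommGroup P] [Module k P]
    [Module.Finite k P] [AddCommGroup X] [Module k X] [AddCommGroup Y] [Module k Y]
    (f : P →ₗ[k] X) (g : P →ₗ[k] Y) (h : LinearMap.ker f ≤ LinearMap.ker g) :
    Module.finrank k (LinearMap.range g) ≤ Module.finrank k (LinearMap.range f) := by
  have hf := f.finrank_range_add_finrank_ker
  have hg := g.finrank_range_add_finrank_ker
  have := Submodule.finrank_mono h
  omega

variable {A : Type*} [CommRing A] [Algebra k A]

/-- If `P` and `Q` pair into `k` through `(a, b) ↦ φ (z * a * b)`, and this pairing only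
degenerates on the kernel of `z` in `P`, then multiplication by `z` has at most the rank on `P`
that it has on `Q`. -/
theorem finrank_map_mulLeft_le (φ : A →ₗ[k] k) (z : A) (P Q : Submodule k A)
    [Module.Finite k P] [Module.Finite k Q]
    (h : ∀ a ∈ P, (∀ b ∈ Q, φ (z * a * b) = 0) → z * a = 0) :
    Module.finrank k (P.map (LinearMap.mulLeft k z)) ≤
      Module.finrank k (Q.map (LinearMap.mulLeft k z)) := by
  set Z := Q.map (LinearMap.mulLeft k z)
  -- Pairing `P` with `zQ` bounds the rank of `f` by `dim zQ`, and `ker f` lies in the kernel of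
  -- `z`.
  let f : P →ₗ[k] Module.Dual k Z :=
    ((LinearMap.mul k A).compr₂ φ).domRestrict₁₂ P Z
  let g : P →ₗ[k] A := (LinearMap.mulLeft k z).domRestrict P
  have hg : LinearMap.range g = P.map (LinearMap.mulLeft k z) :=
    LinearMap.range_domRestrict P _
  rw [← hg]
  refine (finrank_range_le_of_ker_le f g fun a ha => ?_).trans
    ((Submodule.finrank_le _).trans_eq Subspace.dual_finrank_eq)
  refine h a a.2 fun b hb => ?_
  have := LinearMap.congr_fun (LinearMap.mem_ker.mp ha) ⟨z * b, b, hb, rfl⟩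
  have h2 : φ (a * (z * b)) = 0 := this
  rw [← h2]; congr 1; ring

theorem finrank_le_of_pairing (φ : A →ₗ[k] k) (P Q : Submodule k A)
    [Module.Finite k P] [Module.Finite k Q]
    (h : ∀ a ∈ P, (∀ b ∈ Q, φ (a * b) = 0) → a = 0) :
    Module.finrank k P ≤ Module.finrank k Q := by
  have h1 (R : Submodule k A) : R.map (LinearMap.mulLeft k 1) = R := by
    rw [LinearMap.mulLeft_one, Submodule.map_id]
  have := finrank_map_mulLeft_le φ 1 P Q (by simpa only [one_mul] using h)
  rwa [h1, h1] at this

theorem finrank_map_add_finrank_inf_ker {X : Type*} [AddCommGroup X] [Module k X]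
    (f : A →ₗ[k] X) (P : Submodule k A) [Module.Finite k P] :
    Module.finrank k (P.map f) + Module.finrank k ↥(P ⊓ LinearMap.ker f) =
      Module.finrank k P := by
  rw [← (f.domRestrict P).finrank_range_add_finrank_ker, LinearMap.range_domRestrict,
    LinearMap.ker_domRestrict, (Submodule.equivSubtypeMap P _).finrank_eq,
    Submodule.map_comap_subtype]

/-- Multiplication by `y` induces a surjection from `P/zQ` onto `(yP + zP)/zP`; compare dimensions.
-/
theorem finrank_span_pair_mul_add_le (y z : A) (P Q : Submodule k A)
    [Module.Finite k P] [Module.Finite k Q]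
    (hy : ∀ b ∈ Q, y * b ∈ P) (hz : ∀ b ∈ Q, z * b ∈ P) :
    Module.finrank k ↥(Submodule.span k {y, z} * P) +
        Module.finrank k (Q.map (LinearMap.mulLeft k z)) ≤
      Module.finrank k P + Module.finrank k (P.map (LinearMap.mulLeft k z)) := by
  set W := P.map (LinearMap.mulLeft k z)
  set Z := Q.map (LinearMap.mulLeft k z)
  set Y := P.map (LinearMap.mulLeft k y)
  have hsup : Submodule.span k {y, z} * P = Y ⊔ W := by
    rw [Submodule.span_insert, Submodule.sup_mul]
    congr 1 <;> ext <;> simp [W, Y, Submodule.mem_span_singleton_mul]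
  have hZP : Z ≤ P := by rintro _ ⟨b, hb, rfl⟩; exact hz b hb
  have hZ : Z.map (LinearMap.mulLeft k y) ≤ Y ⊓ W := by
    refine le_inf (Submodule.map_mono hZP) ?_
    rintro _ ⟨_, ⟨b, hb, rfl⟩, rfl⟩
    exact ⟨y * b, hy b hb, by simp [mul_left_comm]⟩
  have h1 : Module.finrank k Y + _ = _ :=
    finrank_map_add_finrank_inf_ker (LinearMap.mulLeft k y) P
  have h2 := finrank_map_add_finrank_inf_ker (LinearMap.mulLeft k y) Z
  have h3 := Submodule.finrank_sup_add_finrank_inf_eq Y W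
  have h4 := Submodule.finrank_mono hZ
  have h5 := Submodule.finrank_mono (inf_le_inf_right (LinearMap.ker (LinearMap.mulLeft k y)) hZP)
  rw [hsup]
  omega

/-- Once `V ^ (d + 1)` is generated by multiples of elements of `W`, so are all higher powers. -/
theorem pow_succ_le_mul_pow (V W : Submodule k A) (d : ℕ) (h : V ^ (d + 1) ≤ W * V ^ d) (j : ℕ)
    (hj : d ≤ j) : V ^ (j + 1) ≤ W * V ^ j := by
  obtain ⟨i, rfl⟩ := Nat.exists_eq_add_of_le hj
  calc V ^ (d + i + 1) = V ^ (d + 1) * V ^ i := by ring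
    _ ≤ W * V ^ d * V ^ i := mul_le_mul' h le_rfl
    _ = W * V ^ (d + i) := by ring

end LinearAlgebra

/-! ### Relations among three linear generators -/

theorem map_aeval_homogeneousSubmodule {k A σ : Type*} [Field k] [CommRing A] [Algebra k A]
    (x : σ → A) (d : ℕ) :
    (homogeneousSubmodule σ k d).map (aeval x : MvPolynomial σ k →ₐ[k] A).toLinearMap =
      Submodule.span k (Set.range x) ^ d := by
  rw [← homogeneousSubmodule_one_pow, Submodule.map_pow, homogeneousSubmodule_one_eq_span_X,
    Submodule.map_span, ← Set.range_comp]
  congr 3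
  ext j
  simp

/-- A form of degree `d + 1` in three variables that vanishes at the generators `x`, but not at a
point `p`, makes the degree `d + 1` part a multiple of two linear forms which vanish at `p`. -/
theorem exists_pair_of_aeval_eq_zero {k A : Type*} [Field k] [Infinite k] [CommRing A]
    [Algebra k A] (x : Fin 3 → A) (d : ℕ) (f : MvPolynomial (Fin 3) k)
    (hf : f.IsHomogeneous (d + 1)) (hf0 : f ≠ 0) (hx : aeval x f = 0) :
    ∃ y ∈ Submodule.span k (Set.range x), ∃ z ∈ Submodule.span k (Set.range x),
      Submodule.span k (Set.range x) ^ (d + 1) ≤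
        Submodule.span k {y, z} * Submodule.span k (Set.range x) ^ d := by
  obtain ⟨p, hp⟩ : ∃ p, eval p f ≠ 0 := by
    by_contra! h
    exact hf0 (MvPolynomial.funext fun p => by simp [h p])
  obtain ⟨i, hi⟩ : ∃ i, p i ≠ 0 := by
    by_contra! h
    obtain rfl : p = 0 := funext h
    apply hp
    have := hf.coeff_eq_zero (d := 0) (by simp)
    simpa [constantCoeff_eq] using this
  set S := homogeneousSubmodule (Fin 3) k 1
  let u (j : Fin 2) : MvPolynomial (Fin 3) k :=
    X (i.succAbove j) - C (p (i.succAbove j) / p i) * X i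
  have hu (j) : eval p (u j) = 0 := by simp [u, hi]
  have hXi (j) : (X j : MvPolynomial (Fin 3) k) ∈ S := isHomogeneous_X k j
  have huS (j) : u j ∈ S :=
    (isHomogeneous_X k _).sub (isHomogeneous_C_mul_X _ _)
  set K := Submodule.span k {u 0, u 1}
  have hS : S ≤ K ⊔ Submodule.span k {X i} := by
    have hXK : (X i : MvPolynomial (Fin 3) k) ∈ K ⊔ Submodule.span k {X i} :=
      Submodule.mem_sup_right (Submodule.mem_span_singleton_self _)
    have huK : ∀ j, u j ∈ K ⊔ Submodule.span k {X i} := fun j =>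
      Submodule.mem_sup_left (Submodule.subset_span (by fin_cases j <;> simp))
    simp only [S, homogeneousSubmodule_one_eq_span_X]
    rw [Submodule.span_le, Set.range_subset_iff, Fin.forall_iff_succAbove i]
    refine ⟨hXK, fun j => ?_⟩
    have : (X (i.succAbove j) : MvPolynomial (Fin 3) k) =
        u j + (p (i.succAbove j) / p i) • X i := by simp [u, smul_eq_C_mul]
    rw [this]
    exact add_mem (huK j) (Submodule.smul_mem _ _ hXK)
  -- Modulo the linear forms vanishing at `p`, only powers of `X i` survive.
  have key (m : ℕ) : S ^ (m + 1) ≤ K * S ^ m ⊔ Submodule.span k {X i ^ (m + 1)} := by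
    induction m with
    | zero => simpa using hS
    | succ m ih =>
      rw [pow_succ' S]
      refine (mul_le_mul' hS le_rfl).trans ?_
      rw [Submodule.sup_mul]
      refine sup_le le_sup_left ((mul_le_mul' le_rfl ih).trans ?_)
      rw [Submodule.mul_sup, Submodule.span_mul_span]
      refine sup_le_sup ?_ (by simp [pow_succ'])
      rw [mul_left_comm, pow_succ' S]
      refine mul_le_mul' le_rfl (mul_le_mul' ?_ le_rfl)
      simpa using hXi i
  have hK : ∀ g ∈ K * S ^ d, eval p g = 0 := by
    intro g hg
    induction hg using Submodule.mul_induction_on' with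
    | mem_mul_mem a ha b hb =>
      obtain ⟨s, t, rfl⟩ := Submodule.mem_span_pair.mp ha
      simp [hu, smul_eq_C_mul]
    | add a _ b _ ha hb => simp [ha, hb]
  have hfS : f ∈ S ^ (d + 1) := by
    rw [homogeneousSubmodule_one_pow]; exact hf
  obtain ⟨g, hg, w, hw, hgw⟩ := Submodule.mem_sup.mp (key d hfS)
  obtain ⟨c, rfl⟩ := Submodule.mem_span_singleton.mp hw
  -- Otherwise `f = g` would vanish at `p`. So the relation `f` eliminates the power of `X i` in
  -- `A`.
  have hc : c ≠ 0 := by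
    rintro rfl
    apply hp
    rw [← hgw]
    simp [hK g hg]
  let φ : MvPolynomial (Fin 3) k →ₐ[k] A := aeval x
  have hφS : S.map φ.toLinearMap = Submodule.span k (Set.range x) := by
    simpa using map_aeval_homogeneousSubmodule (k := k) x 1
  have hφS' (j) : φ (u j) ∈ Submodule.span k (Set.range x) := hφS ▸ ⟨_, huS j, rfl⟩
  refine ⟨φ (u 0), hφS' 0, φ (u 1), hφS' 1, ?_⟩
  have hφK : K.map φ.toLinearMap = Submodule.span k {φ (u 0), φ (u 1)} := by
    simp [K, Submodule.map_span, Set.image_pair]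
  rw [← hφK, ← hφS, ← Submodule.map_pow, ← Submodule.map_pow, ← Submodule.map_mul]
  refine (Submodule.map_mono (key d)).trans ?_
  rw [Submodule.map_sup]
  refine sup_le le_rfl ?_
  rw [Submodule.map_span, Submodule.span_le, Set.image_singleton, Set.singleton_subset_iff]
  refine ⟨-(c⁻¹ • g), neg_mem (Submodule.smul_mem _ _ hg), ?_⟩
  have h0 : φ g + c • φ (X i ^ (d + 1)) = 0 := by
    rw [← map_smul, ← map_add, hgw]; exact hx
  change φ (-(c⁻¹ • g)) = φ (X i ^ (d + 1))
  rw [map_neg, map_smul, eq_neg_of_add_eq_zero_left h0, smul_neg, neg_neg, inv_smul_smul₀ hc]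

/-! ### Graded pieces -/

section Grading

variable {k : Type*} [Field k] {n : ℕ} (I : Ideal (MvPolynomial (Fin n) k))

theorem gradedPiece_eq_pow (d : ℕ) : gradedPiece I d = gradedPiece I 1 ^ d := by
  rw [gradedPiece, ← homogeneousSubmodule_one_pow, Submodule.map_pow, gradedPiece]

theorem gradedPiece_one_eq_span : gradedPiece I 1 =
    Submodule.span k (Set.range fun i => Ideal.Quotient.mk I (X i)) := by
  rw [gradedPiece, homogeneousSubmodule_one_eq_span_X, Submodule.map_span, ← Set.range_comp]
  rfl

instance (d : ℕ) : Module.Finite k (gradedPiece I d) := by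
  rw [gradedPiece_eq_pow, gradedPiece_one_eq_span, Module.Finite.iff_fg]
  exact (Submodule.fg_span (Set.finite_range _)).pow d

variable {I}

theorem mul_mem_gradedPiece {a b : MvPolynomial (Fin n) k ⧸ I} {i j : ℕ}
    (ha : a ∈ gradedPiece I i) (hb : b ∈ gradedPiece I j) : a * b ∈ gradedPiece I (i + j) := by
  rw [gradedPiece_eq_pow] at *
  exact (pow_add (gradedPiece I 1) i j).ge (Submodule.mul_mem_mul ha hb)

theorem eq_zero_of_mem_gradedPiece (hI : I.IsHomogeneous (homogeneousSubmodule (Fin n) k))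
    {a : MvPolynomial (Fin n) k ⧸ I} {i j : ℕ} (hij : i ≠ j)
    (hi : a ∈ gradedPiece I i) (hj : a ∈ gradedPiece I j) : a = 0 := by
  obtain ⟨p, hp, rfl⟩ := hi
  obtain ⟨q, hq, hqp⟩ := hj
  have hmem : p - q ∈ I := Ideal.Quotient.eq.mp hqp.symm
  have := homogeneousComponent_mem_of_mem hI hmem i
  rw [map_sub, homogeneousComponent_of_mem hp, homogeneousComponent_of_mem hq, if_pos rfl,
    if_neg hij, sub_zero] at this
  exact Ideal.Quotient.eq_zero_iff_mem.mpr this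

/-- Powers of the irrelevant ideal stabilise; a form of degree `d` congruent modulo `I` to a
polynomial of order above `d` lies in `I`, by homogeneity. -/
theorem exists_gradedPiece_eq_bot (hI : I.IsHomogeneous (homogeneousSubmodule (Fin n) k))
    [IsArtinianRing (MvPolynomial (Fin n) k ⧸ I)] : ∃ N, ∀ d ≥ N, gradedPiece I d = ⊥ := by
  obtain ⟨N, hN⟩ := IsArtinian.monotone_stabilizes
    (⟨fun d => ((idealOfVars (Fin n) k).map (Ideal.Quotient.mk I) ^ d :
        Ideal (MvPolynomial (Fin n) k ⧸ I)),
      fun _ _ h => Ideal.pow_le_pow_right h⟩ : ℕ →o (Ideal (MvPolynomial (Fin n) k ⧸ I))ᵒᵈ)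
  refine ⟨N, fun d hd => (Submodule.eq_bot_iff _).mpr ?_⟩
  rintro _ ⟨p, hp : p.IsHomogeneous d, rfl⟩
  have hpd : p ∈ idealOfVars (Fin n) k ^ d := by
    rw [mem_pow_idealOfVars_iff']
    exact fun x hx => hp.coeff_eq_zero hx.ne
  have hstab : (idealOfVars (Fin n) k).map (Ideal.Quotient.mk I) ^ d =
      (idealOfVars (Fin n) k).map (Ideal.Quotient.mk I) ^ (d + 1) :=
    (hN d hd).symm.trans (hN (d + 1) (hd.trans d.le_succ))
  have hmem := Ideal.mem_map_of_mem (Ideal.Quotient.mk I) hpd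
  rw [Ideal.map_pow, hstab, ← Ideal.map_pow] at hmem
  obtain ⟨q, hq, hqp⟩ :=
    (Ideal.mem_map_iff_of_surjective _ Ideal.Quotient.mk_surjective).mp hmem
  have hpq : p - q ∈ I := Ideal.Quotient.eq.mp hqp.symm
  have hq0 : homogeneousComponent d q = 0 := by
    ext x
    rw [coeff_homogeneousComponent, coeff_zero]
    split_ifs with hx
    · exact (mem_pow_idealOfVars_iff' _ _).mp hq x (by omega)
    · rfl
  have := homogeneousComponent_mem_of_mem hI hpq d
  rw [map_sub, hq0, homogeneousComponent_of_mem hp, if_pos rfl, sub_zero] at this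
  exact Ideal.Quotient.eq_zero_iff_mem.mpr this

end Grading

/-! ### Gorenstein duality -/

section Duality

variable {k : Type*} [Field k] {n : ℕ} {I : Ideal (MvPolynomial (Fin n) k)}

/-- The pairings `A_i × A_(e - i) → A_e ≅ k` of an artinian Gorenstein algebra are nondegenerate,
where `e` is the socle degree. -/
theorem IsArtinianGorenstein.exists_duality (hI : IsArtinianGorenstein I) :
    ∃ (e : ℕ) (φ : (MvPolynomial (Fin n) k ⧸ I) →ₗ[k] k),
      (∀ d > e, gradedPiece I d = ⊥) ∧
      ∀ i j, i + j = e → ∀ a ∈ gradedPiece I i,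
        (∀ b ∈ gradedPiece I j, φ (a * b) = 0) → a = 0 := by
  classical
  have := hI.artinian
  have hex := exists_gradedPiece_eq_bot hI.homogeneous
  have h1 : (1 : MvPolynomial (Fin n) k ⧸ I) ∈ gradedPiece I 0 :=
    ⟨1, isHomogeneous_one _ _, map_one (Ideal.Quotient.mk I)⟩
  have hX (j : Fin n) : Ideal.Quotient.mk I (X j) ∈ gradedPiece I 1 :=
    ⟨X j, isHomogeneous_X k j, rfl⟩
  have hnt : Nontrivial (MvPolynomial (Fin n) k ⧸ I) := by
    by_contra h
    rw [not_nontrivial_iff_subsingleton] at h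
    have := hI.finrank_socle
    rw [Module.finrank_zero_of_subsingleton] at this
    exact zero_ne_one this
  set N := Nat.find hex
  have hN : ∀ d ≥ N, gradedPiece I d = ⊥ := Nat.find_spec hex
  have hN0 : N ≠ 0 := fun h0 => by
    rw [hN 0 h0.le] at h1
    exact one_ne_zero ((Submodule.mem_bot k).mp h1)
  obtain ⟨e, he⟩ := Nat.exists_eq_succ_of_ne_zero hN0
  have he0 : gradedPiece I e ≠ ⊥ := fun h => by
    refine Nat.find_min hex (m := e) (by omega) fun d hd => ?_
    rcases hd.eq_or_lt with rfl | hd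
    · exact h
    · exact hN d (by omega)
  have hsoc : gradedPiece I e ≤ (socle I).restrictScalars k := by
    intro a ha j
    have := mul_mem_gradedPiece (hX j) ha
    rwa [hN (1 + e) (by omega), Submodule.mem_bot] at this
  have hrank : Module.finrank k ((socle I).restrictScalars k) = 1 := hI.finrank_socle
  have hfin : Module.Finite k ((socle I).restrictScalars k) :=
    Module.finite_of_finrank_pos (by omega)
  have heq : gradedPiece I e = (socle I).restrictScalars k := by
    refine Submodule.eq_of_le_of_finrank_le hsoc ?_
    rw [hrank]
    exact Nat.one_le_iff_ne_zero.mpr fun h => he0 (Submodule.finrank_eq_zero.mp h)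
  obtain ⟨s, hs, hs0⟩ := (Submodule.ne_bot_iff _).mp he0
  obtain ⟨φ, hφ⟩ : ∃ φ : Module.Dual k (MvPolynomial (Fin n) k ⧸ I), φ s ≠ 0 := by
    by_contra! h
    exact hs0 ((Module.forall_dual_apply_eq_zero_iff k s).mp h)
  refine ⟨e, φ, fun d hd => hN d (by omega), fun i j hij => ?_⟩
  induction j generalizing i with
  | zero =>
    intro a ha hb
    obtain rfl : i = e := hij
    have ha1 := hb 1 h1
    rw [mul_one] at ha1
    rw [heq] at ha hs
    obtain ⟨c, hc⟩ := (finrank_eq_one_iff_of_nonzero' (⟨s, hs⟩ : (socle I).restrictScalars k)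
      (by simpa using hs0)).mp hrank ⟨a, ha⟩
    obtain rfl : c • s = a := congrArg Subtype.val hc
    rw [map_smul, smul_eq_mul] at ha1
    rw [(mul_eq_zero.mp ha1).resolve_right hφ, zero_smul]
  -- Each `x_l a` annihilates `A_j` under the pairing, hence is zero by induction. So `a` lies in
  -- the socle, which is `A_e`, while its degree is `i ≠ e`.
  | succ j ih =>
    intro a ha hb
    refine eq_zero_of_mem_gradedPiece hI.homogeneous (by omega : i ≠ e) ha ?_
    rw [heq]
    intro l
    refine ih (1 + i) (by omega) _ (mul_mem_gradedPiece (hX l) ha) fun b hbj => ?_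
    rw [mul_right_comm, mul_comm]
    exact hb _ (add_comm 1 j ▸ mul_mem_gradedPiece (hX l) hbj)

end Duality
-- Growth of the Hilbert function
section Unimodality

variable {k : Type*} [Field k] {n : ℕ} {I : Ideal (MvPolynomial (Fin n) k)}

theorem exists_span_eq_gradedPiece_one (hc : codimension I ≤ 3) :
    ∃ x : Fin 3 → MvPolynomial (Fin n) k ⧸ I,
      Submodule.span k (Set.range x) = gradedPiece I 1 := by
  let b := Module.finBasis k (gradedPiece I 1)
  let x (i : Fin 3) : MvPolynomial (Fin n) k ⧸ I :=
    -- Padding by zeros treats every codimension below three together with three.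
    if h : (i : ℕ) < Module.finrank k (gradedPiece I 1) then b ⟨i, h⟩ else 0
  refine ⟨x, le_antisymm ?_ ?_⟩
  · rw [Submodule.span_le, Set.range_subset_iff]
    intro i
    by_cases h : (i : ℕ) < Module.finrank k (gradedPiece I 1)
    · simp [x, h]
    · simp [x, h]
  · have hb := congrArg (Submodule.map (gradedPiece I 1).subtype) b.span_eq
    rw [Submodule.map_span, Submodule.map_subtype_top, ← Set.range_comp] at hb
    rw [← hb, Submodule.span_le, Set.range_subset_iff]
    intro j
    refine Submodule.subset_span ⟨⟨j, j.2.trans_le hc⟩, ?_⟩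
    simp [x]

/-- If `x 0` kills the value of a form `g`, then `X 0 * g` is a relation, so `g = 0` in the
polynomial domain. -/
theorem hilbertFunction_le_succ_of_forall_aeval_ne_zero (x : Fin 3 → MvPolynomial (Fin n) k ⧸ I)
    (hx : Submodule.span k (Set.range x) = gradedPiece I 1) (d : ℕ)
    (h : ∀ f : MvPolynomial (Fin 3) k, f.IsHomogeneous (d + 1) → aeval x f = 0 → f = 0) :
    hilbertFunction I d ≤ hilbertFunction I (d + 1) := by
  have hx0 : x 0 ∈ gradedPiece I 1 := hx ▸ Submodule.subset_span ⟨0, rfl⟩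
  have hmap := finrank_map_add_finrank_inf_ker (LinearMap.mulLeft k (x 0)) (gradedPiece I d)
  have hker : gradedPiece I d ⊓ LinearMap.ker (LinearMap.mulLeft k (x 0)) = ⊥ := by
    refine (Submodule.eq_bot_iff _).mpr ?_
    rintro a ⟨ha, hxa⟩
    rw [SetLike.mem_coe, gradedPiece_eq_pow, ← hx] at ha
    rw [← map_aeval_homogeneousSubmodule] at ha
    obtain ⟨g, hg, rfl⟩ := ha
    have h0 : X 0 * g = 0 := by
      refine h _ (add_comm 1 d ▸ (isHomogeneous_X k 0).mul hg) ?_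
      rw [map_mul, aeval_X]
      exact hxa
    rw [(mul_eq_zero.mp h0).resolve_left (X_ne_zero 0), map_zero]
  rw [hker, finrank_bot, add_zero] at hmap
  rw [hilbertFunction, hilbertFunction, ← hmap]
  refine Submodule.finrank_mono ?_
  rintro _ ⟨a, ha, rfl⟩
  exact add_comm 1 d ▸ mul_mem_gradedPiece hx0 ha

theorem antitone_finrank_add_finrank_map {y z : MvPolynomial (Fin n) k ⧸ I}
    (hy : y ∈ gradedPiece I 1) (hz : z ∈ gradedPiece I 1) {d : ℕ}
    (h : gradedPiece I (d + 1) ≤ Submodule.span k {y, z} * gradedPiece I d) {j : ℕ} (hj : d ≤ j) :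
    hilbertFunction I (j + 1) +
        Module.finrank k ((gradedPiece I d).map (LinearMap.mulLeft k z)) ≤
      hilbertFunction I (d + 1) +
        Module.finrank k ((gradedPiece I j).map (LinearMap.mulLeft k z)) := by
  induction j, hj using Nat.le_induction with
  | base => rfl
  | succ j hj ih =>
    have hle : gradedPiece I (j + 1 + 1) ≤ Submodule.span k {y, z} * gradedPiece I (j + 1) := by
      rw [gradedPiece_eq_pow I (d + 1), gradedPiece_eq_pow I d] at h
      rw [gradedPiece_eq_pow I (j + 1 + 1), gradedPiece_eq_pow I (j + 1)]
      exact pow_succ_le_mul_pow _ _ d h (j + 1) (by omega)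
    have hmul {w} (hw : w ∈ gradedPiece I 1) (b) (hb : b ∈ gradedPiece I j) :
        w * b ∈ gradedPiece I (j + 1) := add_comm 1 j ▸ mul_mem_gradedPiece hw hb
    have hfin : Module.Finite k ↥(Submodule.span k {y, z} * gradedPiece I (j + 1)) :=
      Module.Finite.iff_fg.mpr ((Submodule.fg_span (by simp)).mul
        (Module.Finite.iff_fg.mp inferInstance))
    have h1 := finrank_span_pair_mul_add_le y z (gradedPiece I (j + 1)) (gradedPiece I j)
      (hmul hy) (hmul hz)
    have h2 : hilbertFunction I (j + 1 + 1) ≤ _ := Submodule.finrank_mono hle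
    simp only [hilbertFunction] at *
    omega

theorem hilbertFunction_le_of_duality {e : ℕ} {φ : (MvPolynomial (Fin n) k ⧸ I) →ₗ[k] k}
    (hφ : ∀ i j, i + j = e → ∀ a ∈ gradedPiece I i,
      (∀ b ∈ gradedPiece I j, φ (a * b) = 0) → a = 0) {i j : ℕ} (hij : i + j = e) :
    hilbertFunction I i ≤ hilbertFunction I j :=
  finrank_le_of_pairing φ _ _ (hφ i j hij)

theorem hilbertFunction_le_succ [Infinite k] (hc : codimension I ≤ 3) {e : ℕ}
    {φ : (MvPolynomial (Fin n) k ⧸ I) →ₗ[k] k}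
    (hφ : ∀ i j, i + j = e → ∀ a ∈ gradedPiece I i,
      (∀ b ∈ gradedPiece I j, φ (a * b) = 0) → a = 0) {d : ℕ} (hd : 2 * d + 1 ≤ e) :
    hilbertFunction I d ≤ hilbertFunction I (d + 1) := by
  obtain ⟨x, hx⟩ := exists_span_eq_gradedPiece_one hc
  by_cases h : ∀ f : MvPolynomial (Fin 3) k, f.IsHomogeneous (d + 1) → aeval x f = 0 → f = 0
  · exact hilbertFunction_le_succ_of_forall_aeval_ne_zero x hx d h
  push Not at h
  obtain ⟨f, hf, hxf, hf0⟩ := h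
  obtain ⟨y, hy, z, hz, hyz⟩ := exists_pair_of_aeval_eq_zero x d f hf hf0 hxf
  rw [hx] at hy hz hyz
  have hyz' : gradedPiece I (d + 1) ≤ Submodule.span k {y, z} * gradedPiece I d := by
    rw [gradedPiece_eq_pow I (d + 1), gradedPiece_eq_pow I d]
    exact hyz
  have h1 := antitone_finrank_add_finrank_map hy hz hyz' (j := e - d - 1) (by omega)
  -- `z : A_(e-d-1) → A_(e-d)` is dual to `z : A_d → A_(d+1)`.
  have h2 := finrank_map_mulLeft_le φ z (gradedPiece I (e - d - 1)) (gradedPiece I d)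
    fun a ha hb => hφ (1 + (e - d - 1)) d (by omega) _ (mul_mem_gradedPiece hz ha) hb
  have h3 : hilbertFunction I d ≤ hilbertFunction I (e - d - 1 + 1) :=
    hilbertFunction_le_of_duality hφ (by omega)
  omega

theorem IsArtinianGorenstein.isUnimodal_hilbertFunction [Infinite k]
    (hI : IsArtinianGorenstein I) (hc : codimension I ≤ 3) : IsUnimodal (hilbertFunction I) := by
  obtain ⟨e, φ, he, hφ⟩ := hI.exists_duality
  refine ⟨e / 2, ?_, ?_⟩
  · refine monotoneOn_of_le_succ Set.ordConnected_Iic fun d _ _ hd => ?_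
    rw [Order.succ_eq_add_one, Set.mem_Iic] at *
    exact hilbertFunction_le_succ hc hφ (by omega)
  · refine antitoneOn_of_succ_le Set.ordConnected_Ici fun d _ hd _ => ?_
    rw [Order.succ_eq_add_one, Set.mem_Ici] at *
    rcases lt_or_ge e (d + 1) with h | h
    · rw [hilbertFunction, he _ h, finrank_bot]
      exact Nat.zero_le _
    -- Reflect the ascent: `h_(d+1) ≤ h_(e-d-1) ≤ h_(e-d) ≤ h_d`.
    · have h1 := hilbertFunction_le_of_duality hφ (i := d + 1) (j := e - d - 1) (by omega)
      have h2 := hilbertFunction_le_succ hc hφ (d := e - d - 1) (by omega)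
      have h3 := hilbertFunction_le_of_duality hφ (i := e - d - 1 + 1) (j := d) (by omega)
      exact h1.trans (h2.trans h3)

end Unimodality
end GorensteinH

theorem theorem2p7 {k : Type*} [Field k] [Infinite k] (r : ℕ) (hr : r ≤ 3)
    (h : ℕ → ℕ) (hh : GorensteinH.IsGorensteinHVector k r h) :
    GorensteinH.IsUnimodal h := by
  obtain ⟨n, I, hI, rfl, rfl⟩ := hh
  exact hI.isUnimodal_hilbertFunction hr
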